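/- Let $V$ be a finite set, let $B\in\mathbb{R}^{V\times V}$ satisfy $\det(I-B)\neq 0$, let $\varepsilon=(\varepsilon_v)_{v\in V}$ be mutually independent real random variables on a probability space, and let $X=(X_v)_{v\in V}$ be the (almost surely unique) solution of the linear cyclic structural causal model $X=BX+\varepsilon$, i.e. $X=(I-B)^{-1}\varepsilon$ almost surely. Let $G$ be the directed graph on $V$ with an edge $u\to v$ whenever $B_{vu}\neq 0$; $G$ may contain cycles. Let $G^{\mathrm{sc}}$ be its condensation: the vertices of $G^{\mathrm{sc}}$ are the strongly connected components (the classes of mutual reachability) of $G$, and there is an edge $\pi\to\pi'$ whenever $\pi\neq\pi'$ and $G$ has an edge $u\to v$ with $u\in\pi$, $v\in\pi'$. For each component $\pi$ let $X_\pi=(X_v)_{v\in\pi}$ be the corresponding vector-valued cluster variable. Then $G^{\mathrm{sc}}$ is acyclic, and the joint distribution of the cluster variables $(X_\pi)_\pi$ is Markov with respect to $G^{\mathrm{sc}}$: for all pairwise disjoint sets $S,T,Z$ of components such that $Z$ d-separates $S$ from $T$ in $G^{\mathrm{sc}}$, the families $(X_\pi)_{\pi\in S}$ and $(X_\pi)_{\pi\in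 T}$ are conditionally independent given $(X_\pi)_{\pi\in Z}$. Here $Z$ d-separates $S$ from $T$ if no walk from a vertex of $S$ to a vertex of $T$ (edges may be traversed in either direction) is open given $Z$; a walk is open given $Z$ if its end points are not in $Z$, each interior vertex at which two arrowheads of the walk meet (a collider) is in $Z$ or has a descendant in $Z$, and no other interior vertex is in $Z$. -/

import Mathlib

open MeasureTheory ProbabilityTheory

noncomputable section

namespace CyclicSCM

section Graph

variable {V W : Type*}

/-- `u ⇝ v`: there is a directed path, possibly of length `0`, from `u` to `v`. -/
def Reaches (G : Digraph V) (u v : V) : Prop := Relation.ReflTransGen G.Adj u v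

/-- No directed cycle (of positive length; self-loops count as cycles). -/
def IsAcyclic (G : Digraph V) : Prop := ∀ v, ¬ Relation.TransGen G.Adj v v

/-- Mutual reachability; its classes are the strongly connected components. -/
def sccSetoid (G : Digraph V) : Setoid V where
  r u v := Reaches G u v ∧ Reaches G v u
  iseqv :=
    { refl := fun _ => ⟨.refl, .refl⟩
      symm := fun h => ⟨h.2, h.1⟩
      trans := fun h k => ⟨h.1.trans k.1, k.2.trans h.2⟩ }

/-- The set of strongly connected components of `G`. -/
abbrev SCC (G : Digraph V) : Type _ := Quotient (sccSetoid G)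

/-- The component containing a given vertex. -/
def scc (G : Digraph V) (v : V) : SCC G := Quotient.mk (sccSetoid G) v

/-- The vertices belonging to the component `c`. -/
abbrev Cluster (G : Digraph V) (c : SCC G) : Type _ := {v : V // scc G v = c}

/-- The quotient of `G` along `χ`: an edge `χ u → χ v` for every edge `u → v` with `χ u ≠ χ v`. -/
def quotientGraph (G : Digraph V) (χ : V → W) : Digraph W where
  Adj c d := ∃ u v, G.Adj u v ∧ χ u ≠ χ v ∧ χ u = c ∧ χ v = d

/-- The condensation of `G`: the quotient by the partition into strongly connected components. -/
def condensation (G : Digraph V) : Digraph (SCC G) := quotientGraph G (scc G)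

/-- A walk `node 0, …, node len` in the skeleton of `G`, each step carrying the orientation of the
edge it traverses: `node k → node (k + 1)` if `fwd k`, and `node k ← node (k + 1)` otherwise.
The values of `node` beyond `len`, and of `fwd` from `len` on, are irrelevant. -/
structure Walk (G : Digraph V) where
  /-- number of edges -/
  len : ℕ
  /-- vertices -/
  node : ℕ → V
  /-- orientations -/
  fwd : ℕ → Prop
  adj_fwd : ∀ k < len, fwd k → G.Adj (node k) (node (k + 1))
  adj_bwd : ∀ k < len, ¬ fwd k → G.Adj (node (k + 1)) (node k)

/-- The interior vertex `node (k + 1)` is a collider: `node k → node (k + 1) ← node (k + 2)`. -/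
def Walk.IsCollider {G : Digraph V} (p : Walk G) (k : ℕ) : Prop := p.fwd k ∧ ¬ p.fwd (k + 1)

/-- `p` is open given `C`: its end points are not in `C`, each of its colliders is in `C` or has a
descendant in `C`, and none of its interior non-colliders is in `C`. -/
def Walk.IsOpen {G : Digraph V} (p : Walk G) (C : Set V) : Prop :=
  p.node 0 ∉ C ∧ p.node p.len ∉ C ∧
    ∀ k, k + 1 < p.len →
      (p.IsCollider k → ∃ c ∈ C, Reaches G (p.node (k + 1)) c) ∧
      (¬ p.IsCollider k → p.node (k + 1) ∉ C)

/-- `A` and `B` are d-separated by `C`: no walk from `A` to `B` is open given `C`. -/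
def DSep (G : Digraph V) (A B C : Set V) : Prop :=
  ∀ p : Walk G, p.node 0 ∈ A → p.node p.len ∈ B → ¬ p.IsOpen C

end Graph

section Markov

variable {ι : Type*}

/-- The coordinates with index in `A`. -/
def proj (𝓧 : ι → Type*) (A : Set ι) (x : ∀ i, 𝓧 i) : ∀ i : A, 𝓧 i := fun i => x i

theorem measurable_proj {𝓧 : ι → Type*} [∀ i, MeasurableSpace (𝓧 i)] (A : Set ι) :
    Measurable (proj 𝓧 A) :=
  measurable_pi_lambda _ fun i => measurable_pi_apply (i : ι)

/-- The (global, directed) Markov property of a joint distribution `P` of variables indexed by the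
vertices of `G`: whenever `C` d-separates `A` from `B`, the variables in `A` and those in `B` are
conditionally independent given those in `C`. -/
def IsMarkov [Countable ι] {𝓧 : ι → Type*} [∀ i, MeasurableSpace (𝓧 i)]
    [∀ i, StandardBorelSpace (𝓧 i)] (G : Digraph ι) (P : Measure (∀ i, 𝓧 i)) [IsFiniteMeasure P] : Prop :=
  ∀ A B C : Set ι, Disjoint A B → Disjoint A C → Disjoint B C → DSep G A B C →
    CondIndepFun (MeasurableSpace.comap (proj 𝓧 C) inferInstance)
      (measurable_proj C).comap_le (proj 𝓧 A) (proj 𝓧 B) P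

end Markov

section SCM

variable {V Ω : Type*}

/-- The directed graph of a weighted adjacency matrix: `u → v` if and only if `B v u ≠ 0`. -/
def graph (B : Matrix V V ℝ) : Digraph V where
  Adj u v := B v u ≠ 0

/-- The linear cyclic structural causal model `X = B X + ε` with mutually independent noise
variables `ε v` and `det (I - B) ≠ 0`. -/
structure IsLinearSCM [Fintype V] [DecidableEq V] [MeasurableSpace Ω] (μ : Measure Ω)
    (B : Matrix V V ℝ) (ε X : V → Ω → ℝ) : Prop where
  measurable_noise : ∀ v, Measurable (ε v)
  indep_noise : iIndepFun ε μ
  det_ne_zero : (1 - B).det ≠ 0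
  structural_eq : ∀ᵐ ω ∂μ, ∀ v, X v ω = ∑ w, B v w * X w ω + ε v ω

/-- The joint distribution of the cluster variables `X_c = (X v)_{v ∈ c}`, where `c` runs over the
strongly connected components of `G`. -/
def clusterLaw [MeasurableSpace Ω] (μ : Measure Ω) (G : Digraph V) (X : V → Ω → ℝ) :
    Measure (∀ c : SCC G, Cluster G c → ℝ) :=
  μ.map fun ω _ v => X v ω

instance [MeasurableSpace Ω] (μ : Measure Ω) [IsFiniteMeasure μ] (G : Digraph V)
    (X : V → Ω → ℝ) : IsFiniteMeasure (clusterLaw μ G X) :=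
  inferInstanceAs (IsFiniteMeasure (μ.map _))

end SCM

end CyclicSCM

end

open MeasureTheory ProbabilityTheory

namespace CyclicSCM

/-! ### Conditional independence of σ-algebras. -/

section CondIndep

variable {Ω : Type*} {m' m₁ m₂ m₃ mΩ : MeasurableSpace Ω} {μ : Measure Ω}

/-! Ordering the components topologically makes `1 - B` block triangular, so its determinant is the
product of the determinants of its diagonal blocks and each block is invertible
(`det_toSquareBlock_scc_ne_zero`). Solving the equations of one component for its own variables
therefore expresses the cluster variable through the noise of that component and the parent clusters
(`clusterSigma_le_sup`). The clusters thus form a recursive system on an acyclic graph with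
independent noise blocks, and such a system satisfies the global Markov property.

The latter is proved for σ-algebras. Within the ancestors of `A ∪ B ∪ C`, the vertices outside `C`
are divided according to whether an open walk from `A` reaches them; no vertex together with its
parents meets both parts (`DSep.exists_partition`). Conditional independence of the two parts given
`C` follows by deleting sinks one at a time (`condIndep_sigma_of_partition`): a sink is independent
of the rest given any set containing its parents, and contraction and weak union put it back. -/

theorem isPiSystem_inter_measurableSet (m₁ m₂ : MeasurableSpace Ω) :
    IsPiSystem {s | ∃ c a, MeasurableSet[m₁] c ∧ MeasurableSet[m₂] a ∧ s = c ∩ a} := by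
  rintro _ ⟨c, a, hc, ha, rfl⟩ _ ⟨c', a', hc', ha', rfl⟩ -
  exact ⟨c ∩ c', a ∩ a', hc.inter hc', ha.inter ha', Set.inter_inter_inter_comm _ _ _ _⟩

theorem sup_eq_generateFrom_inter (m₁ m₂ : MeasurableSpace Ω) :
    m₁ ⊔ m₂ = MeasurableSpace.generateFrom
      {s | ∃ c a, MeasurableSet[m₁] c ∧ MeasurableSet[m₂] a ∧ s = c ∩ a} := by
  apply le_antisymm
  · refine sup_le (fun c hc => ?_) (fun a ha => ?_)
    · exact MeasurableSpace.measurableSet_generateFrom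
        ⟨c, Set.univ, hc, MeasurableSet.univ, (Set.inter_univ c).symm⟩
    · exact MeasurableSpace.measurableSet_generateFrom
        ⟨Set.univ, a, MeasurableSet.univ, ha, (Set.univ_inter a).symm⟩
  · refine MeasurableSpace.generateFrom_le ?_
    rintro _ ⟨c, a, hc, ha, rfl⟩
    exact ((le_sup_left : m₁ ≤ m₁ ⊔ m₂) _ hc).inter ((le_sup_right : m₂ ≤ m₁ ⊔ m₂) _ ha)

/-- If two integrable functions have the same integral over every set of a generating π-system
that contains the whole space, they have the same integral over every set of the σ-algebra. -/
theorem setIntegral_eq_of_generateFrom {f g : Ω → ℝ} {m : MeasurableSpace Ω} (hm : m ≤ mΩ)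
    {S : Set (Set Ω)} (hS : m = MeasurableSpace.generateFrom S) (hpi : IsPiSystem S)
    (huniv : Set.univ ∈ S) (hf : Integrable f μ) (hg : Integrable g μ)
    (h : ∀ s ∈ S, ∫ x in s, f x ∂μ = ∫ x in s, g x ∂μ) (s : Set Ω) (hs : MeasurableSet[m] s) :
    ∫ x in s, f x ∂μ = ∫ x in s, g x ∂μ := by
  induction s, hs using MeasurableSpace.induction_on_inter hS hpi with
  | empty => simp
  | basic s hs => exact h s hs
  | compl s hs ih =>
    rw [setIntegral_compl (hm _ hs) hf, setIntegral_compl (hm _ hs) hg, ih]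
    have := h _ huniv
    simp only [setIntegral_univ] at this
    rw [this]
  | iUnion s hd hs ih =>
    rw [integral_iUnion (fun i => hm _ (hs i)) hd hf.integrableOn,
      integral_iUnion (fun i => hm _ (hs i)) hd hg.integrableOn]
    simp_rw [ih]

variable [IsFiniteMeasure μ]

theorem indicator_one_mul_eq (s : Set Ω) (f : Ω → ℝ) :
    s.indicator (fun _ => (1 : ℝ)) * f = s.indicator f := by
  ext x; by_cases hx : x ∈ s <;> simp [hx]

theorem condExp_indicator_mul_condExp {s t : Set Ω} (hs : MeasurableSet s) :
    μ[s.indicator (μ⟦t|m'⟧) | m'] =ᵐ[μ] (μ⟦s|m'⟧) * (μ⟦t|m'⟧) := by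
  rw [← indicator_one_mul_eq]
  refine condExp_mul_of_stronglyMeasurable_right stronglyMeasurable_condExp ?_
    ((integrable_const _).indicator hs)
  rw [indicator_one_mul_eq]
  exact integrable_condExp.indicator hs

/-- Two σ-algebras are conditionally independent given a third one if and only if adding the first
to the conditioning does not change the conditional probabilities of the events of the second. -/
theorem condIndep_iff_condExp_sup_eq [StandardBorelSpace Ω] (hm' : m' ≤ mΩ) (hm₁ : m₁ ≤ mΩ)
    (hm₂ : m₂ ≤ mΩ) :
    CondIndep m' m₁ m₂ hm' μ ↔ ∀ t, MeasurableSet[m₂] t → μ⟦t|m' ⊔ m₁⟧ =ᵐ[μ] μ⟦t|m'⟧ := by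
  have hsup : m' ⊔ m₁ ≤ mΩ := sup_le hm' hm₁
  rw [condIndep_iff _ _ _ hm' hm₁ hm₂]
  constructor
  · intro h t ht
    have hint : Integrable (t.indicator fun _ => (1 : ℝ)) μ :=
      (integrable_const _).indicator (hm₂ _ ht)
    have hsm : StronglyMeasurable[m' ⊔ m₁] (μ⟦t|m'⟧) :=
      stronglyMeasurable_condExp.mono le_sup_left
    refine (ae_eq_condExp_of_forall_setIntegral_eq hsup hint
      (fun s _ _ => integrable_condExp.integrableOn) (fun s hs _ => ?_)
      hsm.aestronglyMeasurable).symm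
    -- On a set `c ∩ a`, the event `a` is moved into the integrand; conditioning on `m'` then
    -- reduces the claim to the product formula for `a` and `t`.
    refine setIntegral_eq_of_generateFrom hsup (sup_eq_generateFrom_inter m' m₁)
      (isPiSystem_inter_measurableSet m' m₁)
      ⟨Set.univ, Set.univ, MeasurableSet.univ, MeasurableSet.univ, by simp⟩
      integrable_condExp hint ?_ s hs
    rintro _ ⟨c, a, hc, ha, rfl⟩
    rw [← setIntegral_indicator (hm₁ _ ha), ← setIntegral_indicator (hm₁ _ ha),
      ← setIntegral_condExp hm' (integrable_condExp.indicator (hm₁ _ ha)) hc,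
      ← setIntegral_condExp hm' (hint.indicator (hm₁ _ ha)) hc]
    refine integral_congr_ae (ae_restrict_of_ae ?_)
    refine (condExp_indicator_mul_condExp (hm₁ _ ha)).trans ((h a t ha ht).symm.trans ?_)
    rw [Set.indicator_indicator]
  · intro h a t ha ht
    have hint : Integrable (t.indicator fun _ => (1 : ℝ)) μ :=
      (integrable_const _).indicator (hm₂ _ ht)
    have ha' : MeasurableSet[m' ⊔ m₁] a := (le_sup_right : m₁ ≤ m' ⊔ m₁) _ ha
    calc μ⟦a ∩ t|m'⟧ =ᵐ[μ] μ[μ⟦a ∩ t|m' ⊔ m₁⟧|m'] :=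
          (condExp_condExp_of_le le_sup_left hsup).symm
      _ =ᵐ[μ] μ[a.indicator (μ⟦t|m'⟧)|m'] := by
          refine condExp_congr_ae ?_
          rw [← Set.indicator_indicator]
          refine (condExp_indicator hint ha').trans ?_
          filter_upwards [h t ht] with x hx
          by_cases hxa : x ∈ a <;> simp [hxa, hx]
      _ =ᵐ[μ] (μ⟦a|m'⟧) * (μ⟦t|m'⟧) := condExp_indicator_mul_condExp (hm₁ _ ha)

variable [StandardBorelSpace Ω]

/-- The criterion `condIndep_iff_condExp_sup_eq` involves `m₂` only through its join with `m'`,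
which adjoining `m'` does not change. -/
theorem condIndep_sup_self_right {hm' : m' ≤ mΩ} (hm₁ : m₁ ≤ mΩ) (hm₂ : m₂ ≤ mΩ)
    (h : CondIndep m' m₁ m₂ hm' μ) : CondIndep m' m₁ (m₂ ⊔ m') hm' μ := by
  refine CondIndep.symm ?_
  replace h := h.symm
  rw [condIndep_iff_condExp_sup_eq hm' hm₂ hm₁] at h
  rw [condIndep_iff_condExp_sup_eq hm' (sup_le hm₂ hm') hm₁]
  rwa [sup_comm m₂ m', ← sup_assoc, sup_idem]

/-- Contraction. -/
theorem condIndep_sup_left {hm' : m' ≤ mΩ} (hm₁ : m₁ ≤ mΩ) (hm₂ : m₂ ≤ mΩ) (hm₃ : m₃ ≤ mΩ)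
    (h : CondIndep m' m₁ m₂ hm' μ) (h' : CondIndep (m' ⊔ m₁) m₃ m₂ (sup_le hm' hm₁) μ) :
    CondIndep m' (m₁ ⊔ m₃) m₂ hm' μ := by
  rw [condIndep_iff_condExp_sup_eq _ hm₁ hm₂] at h
  rw [condIndep_iff_condExp_sup_eq _ hm₃ hm₂] at h'
  rw [condIndep_iff_condExp_sup_eq _ (sup_le hm₁ hm₃) hm₂, ← sup_assoc]
  exact fun t ht => (h' t ht).trans (h t ht)

/-- Weak union. -/
theorem condIndep_sup_of_condIndep_sup_left {hm' : m' ≤ mΩ} (hm₁ : m₁ ≤ mΩ) (hm₂ : m₂ ≤ mΩ)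
    (hm₃ : m₃ ≤ mΩ) (h : CondIndep m' (m₁ ⊔ m₃) m₂ hm' μ) :
    CondIndep (m' ⊔ m₃) m₁ m₂ (sup_le hm' hm₃) μ := by
  have h₃ := condIndep_of_condIndep_of_le_left h (le_sup_right : m₃ ≤ m₁ ⊔ m₃)
  rw [condIndep_iff_condExp_sup_eq _ (sup_le hm₁ hm₃) hm₂] at h
  rw [condIndep_iff_condExp_sup_eq _ hm₃ hm₂] at h₃
  rw [condIndep_iff_condExp_sup_eq _ hm₁ hm₂, sup_assoc, sup_comm m₃]
  exact fun t ht => (h t ht).trans (h₃ t ht).symm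

/-- Events of `m₂` are independent of `m₁` and hence of `m'`, so conditioning on either returns the
unconditional probability. -/
theorem condIndep_of_indep_of_le {hm' : m' ≤ mΩ} (hm₁ : m₁ ≤ mΩ) (hm₂ : m₂ ≤ mΩ)
    (h : Indep m₂ m₁ μ) (hle : m' ≤ m₁) : CondIndep m' m₁ m₂ hm' μ := by
  rw [condIndep_iff_condExp_sup_eq _ hm₁ hm₂, sup_eq_right.2 hle]
  intro t ht
  have ht' : StronglyMeasurable[m₂] (t.indicator fun _ => (1 : ℝ)) :=
    stronglyMeasurable_const.indicator ht
  exact (condExp_indep_eq hm₂ hm₁ ht' h).trans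
    (condExp_indep_eq hm₂ hm' ht' (indep_of_indep_of_le_right h hle)).symm

end CondIndep

/-! ### d-separation and moral separation. -/

section DSep

variable {V : Type*} {G : Digraph V} {A B C : Set V}

/-- The vertices `v` for which there is a walk from `A` to `v`, open given `C` except that `v` itself
may be in `C`; the flag tells whether the walk has an arrowhead at `v`. -/
inductive OpenConn (G : Digraph V) (A C : Set V) : V → Prop → Prop
  | start {a : V} (ha : a ∈ A) (haC : a ∉ C) : OpenConn G A C a False
  | fwd {u w : V} {d : Prop} (hu : OpenConn G A C u d) (huC : u ∉ C) (h : G.Adj u w) :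
      OpenConn G A C w True
  | bwd {u w : V} {d : Prop} (hu : OpenConn G A C u d) (hd : d → ∃ c ∈ C, Reaches G u c)
      (hd' : ¬ d → u ∉ C) (h : G.Adj w u) : OpenConn G A C w False

/-- The walk `p` prolonged by one edge. -/
def Walk.snoc (p : Walk G) (w : V) (b : Prop) (hf : b → G.Adj (p.node p.len) w)
    (hb : ¬ b → G.Adj w (p.node p.len)) : Walk G where
  len := p.len + 1
  node k := if k ≤ p.len then p.node k else w
  fwd k := if k < p.len then p.fwd k else b
  adj_fwd k hk h := by
    rcases Nat.lt_succ_iff_lt_or_eq.1 hk with hk | rfl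
    · simpa [hk.le, Nat.succ_le_of_lt hk] using p.adj_fwd k hk (by simpa [hk] using h)
    · simpa using hf (by simpa using h)
  adj_bwd k hk h := by
    rcases Nat.lt_succ_iff_lt_or_eq.1 hk with hk | rfl
    · simpa [hk.le, Nat.succ_le_of_lt hk] using p.adj_bwd k hk (by simpa [hk] using h)
    · simpa using hb (by simpa using h)

theorem OpenConn.exists_walk {v : V} {d : Prop} (h : OpenConn G A C v d) :
    ∃ p : Walk G, p.node 0 ∈ A ∧ p.node 0 ∉ C ∧ p.node p.len = v ∧
      (∀ k, k + 1 = p.len → (p.fwd k ↔ d)) ∧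
      ∀ k, k + 1 < p.len →
        (p.IsCollider k → ∃ c ∈ C, Reaches G (p.node (k + 1)) c) ∧
        (¬ p.IsCollider k → p.node (k + 1) ∉ C) := by
  -- Extension by one edge. The old end point becomes a collider exactly when the walk arrives with
  -- an arrowhead (`d`) and the new edge points back (`¬ b`). For a walk of length zero the
  -- condition on `d` is vacuous.
  have key : ∀ (u w : V) (d : Prop) (p : Walk G) (b : Prop), p.node 0 ∈ A → p.node 0 ∉ C →
      p.node p.len = u → (∀ k, k + 1 = p.len → (p.fwd k ↔ d)) →
      (∀ k, k + 1 < p.len →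
        (p.IsCollider k → ∃ c ∈ C, Reaches G (p.node (k + 1)) c) ∧
        (¬ p.IsCollider k → p.node (k + 1) ∉ C)) →
      (b → G.Adj u w) → (¬ b → G.Adj w u) → (d ∧ ¬ b → ∃ c ∈ C, Reaches G u c) →
      (¬ (d ∧ ¬ b) → u ∉ C) →
      ∃ p : Walk G, p.node 0 ∈ A ∧ p.node 0 ∉ C ∧ p.node p.len = w ∧
      (∀ k, k + 1 = p.len → (p.fwd k ↔ b)) ∧
      ∀ k, k + 1 < p.len →
        (p.IsCollider k → ∃ c ∈ C, Reaches G (p.node (k + 1)) c) ∧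
        (¬ p.IsCollider k → p.node (k + 1) ∉ C) := by
    intro u w d p b h0 h0C hu hd hk hbf hbb hc hnc
    subst hu
    refine ⟨p.snoc w b hbf hbb, by simpa [Walk.snoc] using h0, by simpa [Walk.snoc] using h0C,
      by simp [Walk.snoc], ?_, ?_⟩
    · intro k hk
      have : k = p.len := by simpa [Walk.snoc] using hk
      simp [Walk.snoc, this]
    · intro k hk'
      have hk' : k + 1 ≤ p.len := by simpa [Walk.snoc, Nat.lt_succ_iff] using hk'
      rcases hk'.lt_or_eq with h | h
      · have e : (p.snoc w b hbf hbb).IsCollider k ↔ p.IsCollider k := by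
          simp [Walk.IsCollider, Walk.snoc, h, (Nat.lt_succ_self k).trans h]
        have e' : (p.snoc w b hbf hbb).node (k + 1) = p.node (k + 1) := by
          simp [Walk.snoc, h.le]
        rw [e, e']
        exact hk k h
      · have e : (p.snoc w b hbf hbb).IsCollider k ↔ d ∧ ¬ b := by
          have hlt : k < p.len := by omega
          simp [Walk.IsCollider, Walk.snoc, h, hlt, hd k h]
        have e' : (p.snoc w b hbf hbb).node (k + 1) = p.node p.len := by
          simp [Walk.snoc, h]
        rw [e, e']
        exact ⟨hc, hnc⟩
  induction h with
  | @start a ha haC =>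
    exact ⟨⟨0, fun _ => a, fun _ => False, by simp, by simp⟩, ha, haC, rfl, by simp, by simp⟩
  | @fwd u w d hu huC h ih =>
    obtain ⟨p, h0, h0C, hu, hd, hk⟩ := ih
    exact key u w d p True h0 h0C hu hd hk (fun _ => h) (by simp) (by simp) (fun _ => huC)
  | @bwd u w d hu hdt hdf h ih =>
    obtain ⟨p, h0, h0C, hu, hd, hk⟩ := ih
    exact key u w d p False h0 h0C hu hd hk (by simp) (fun _ => h) (by simpa using hdt)
      (by simpa using hdf)

theorem DSep.not_openConn (h : DSep G A B C) (hBC : Disjoint B C) {b : V} (hb : b ∈ B) {d : Prop} :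
    ¬ OpenConn G A C b d := by
  intro hc
  obtain ⟨p, h0, h0C, rfl, -, hk⟩ := hc.exists_walk
  exact h p h0 hb ⟨h0C, Set.disjoint_left.1 hBC hb, hk⟩

/-- The ancestors of a set of vertices. -/
def ancestors (G : Digraph V) (S : Set V) : Set V := {v | ∃ s ∈ S, Reaches G v s}

theorem subset_ancestors (G : Digraph V) (S : Set V) : S ⊆ ancestors G S :=
  fun s hs => ⟨s, hs, .refl⟩

theorem mem_ancestors_of_adj {S : Set V} {u v : V} (h : G.Adj u v) (hv : v ∈ ancestors G S) :
    u ∈ ancestors G S := by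
  obtain ⟨s, hs, hvs⟩ := hv
  exact ⟨s, hs, hvs.head h⟩

/-- A directed path starting at a non-ancestor of `C` never enters `C`, and following it creates no
colliders. -/
theorem OpenConn.of_reaches {u x : V} {d : Prop} (h : OpenConn G A C u d) (hux : Reaches G u x)
    (hu : u ∉ ancestors G C) : ∃ d', OpenConn G A C x d' := by
  induction hux using Relation.ReflTransGen.head_induction_on generalizing d with
  | refl => exact ⟨d, h⟩
  | head hab _ ih =>
    exact ih (h.fwd (fun hC => hu (subset_ancestors G C hC)) hab)
      (fun hb => hu (mem_ancestors_of_adj hab hb))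

theorem OpenConn.of_reaches_source {u a : V} (ha : a ∈ A) (hua : Reaches G u a)
    (hu : u ∉ ancestors G C) : OpenConn G A C u False := by
  induction hua using Relation.ReflTransGen.head_induction_on with
  | refl => exact .start ha (fun hC => hu (subset_ancestors G C hC))
  | head hab _ ih =>
    have hb := fun hb => hu (mem_ancestors_of_adj hab hb)
    exact (ih hb).bwd False.elim (fun _ hC => hb (subset_ancestors G C hC)) hab

/-- If `u` is an ancestor of `C`, stepping back to `w` is allowed whether or not `u` becomes a
collider. Otherwise `u` leads to `A`, and a fresh walk climbs from there through `u` to `w`, or to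
`B`, which would complete an open walk from `A` to `B`. -/
theorem OpenConn.exists_of_adj (h : DSep G A B C) (hBC : Disjoint B C) {u w : V} {d : Prop}
    (hu : OpenConn G A C u d) (huD : u ∈ ancestors G (A ∪ B ∪ C)) (huC : u ∉ C)
    (hwu : G.Adj w u) : ∃ d', OpenConn G A C w d' := by
  by_cases hC : u ∈ ancestors G C
  · exact ⟨_, hu.bwd (fun _ => hC) (fun _ => huC) hwu⟩
  · obtain ⟨x, (hx | hx) | hx, hux⟩ := huD
    · exact ⟨_, (OpenConn.of_reaches_source hx hux hC).bwd False.elim (fun _ => huC) hwu⟩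
    · obtain ⟨d', hd'⟩ := hu.of_reaches hux hC
      exact (h.not_openConn hBC hx hd').elim
    · exact (hC ⟨x, hx, hux⟩).elim

/-- A vertex together with its parents. -/
def family (G : Digraph V) (v : V) : Set V := insert v {u | G.Adj u v}

/-- If `C` d-separates `A` from `B`, then the ancestors of `A ∪ B ∪ C` outside `C` split into two
parts, one containing `A` and the other `B`, such that no family meets both of them. -/
theorem DSep.exists_partition (h : DSep G A B C) (hAC : Disjoint A C) (hBC : Disjoint B C) :
    ∃ A' B' : Set V, A ⊆ A' ∧ B ⊆ B' ∧ Disjoint A' B' ∧ Disjoint A' C ∧ Disjoint B' C ∧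
      A' ∪ B' ∪ C = ancestors G (A ∪ B ∪ C) ∧
      ∀ v ∈ A' ∪ B' ∪ C, family G v ⊆ A' ∪ C ∨ family G v ⊆ B' ∪ C := by
  classical
  set D := ancestors G (A ∪ B ∪ C) with hD
  have hsub : A ∪ B ∪ C ⊆ D := subset_ancestors G _
  have hfamD : ∀ v ∈ D, family G v ⊆ D := by
    rintro v hv u (rfl | hu)
    · exact hv
    · exact mem_ancestors_of_adj hu hv
  -- Open reachability spreads from one member of a family outside `C` to all of them: two parents
  -- are linked through their child `w`, which is an open collider when `w ∈ C` and is handled by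
  -- `exists_of_adj` otherwise.
  have hclosed : ∀ w ∈ D, ∀ u ∈ family G w, u ∉ C → (∃ d, OpenConn G A C u d) →
      ∀ u' ∈ family G w, u' ∉ C → ∃ d, OpenConn G A C u' d := by
    rintro w hw u hu huC ⟨d, hd⟩ u' hu' hu'C
    have hself : ∀ d, w ∉ C → OpenConn G A C w d → ∃ d, OpenConn G A C u' d := by
      intro d hwC hd
      rcases hu' with rfl | hu'
      · exact ⟨d, hd⟩
      · exact hd.exists_of_adj h hBC hw hwC hu'
    rcases hu with rfl | hu
    · exact hself d huC hd
    · have hw' : OpenConn G A C w True := hd.fwd huC hu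
      by_cases hwC : w ∈ C
      · rcases hu' with rfl | hu'
        · exact (hu'C hwC).elim
        · exact ⟨_, hw'.bwd (fun _ => ⟨w, hwC, .refl⟩) (fun hn => (hn trivial).elim) hu'⟩
      · exact hself _ hwC hw'
  refine ⟨{v | v ∈ D ∧ v ∉ C ∧ ∃ d, OpenConn G A C v d},
    {v | v ∈ D ∧ v ∉ C ∧ ¬ ∃ d, OpenConn G A C v d}, ?_, ?_, ?_, ?_, ?_, ?_, ?_⟩
  · intro a ha
    have haC := Set.disjoint_left.1 hAC ha
    exact ⟨hsub (.inl (.inl ha)), haC, _, .start ha haC⟩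
  · intro b hb
    exact ⟨hsub (.inl (.inr hb)), Set.disjoint_left.1 hBC hb,
      fun ⟨d, hd⟩ => h.not_openConn hBC hb hd⟩
  · exact Set.disjoint_left.2 fun v hv hv' => hv'.2.2 hv.2.2
  · exact Set.disjoint_left.2 fun v hv hC => hv.2.1 hC
  · exact Set.disjoint_left.2 fun v hv hC => hv.2.1 hC
  · ext v
    constructor
    · rintro ((hv | hv) | hv)
      exacts [hv.1, hv.1, hsub (.inr hv)]
    · intro hv
      by_cases hC : v ∈ C
      · exact .inr hC
      · by_cases hc : ∃ d, OpenConn G A C v d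
        exacts [.inl (.inl ⟨hv, hC, hc⟩), .inl (.inr ⟨hv, hC, hc⟩)]
  · intro v hv
    have hvD : v ∈ D := by
      rcases hv with (hv | hv) | hv
      exacts [hv.1, hv.1, hsub (.inr hv)]
    by_cases hex : ∃ u ∈ family G v, u ∉ C ∧ ∃ d, OpenConn G A C u d
    · obtain ⟨u, hu, huC, hud⟩ := hex
      left
      intro u' hu'
      by_cases hC : u' ∈ C
      · exact .inr hC
      · exact .inl ⟨hfamD v hvD hu', hC, hclosed v hvD u hu huC hud u' hu' hC⟩
    · right
      intro u' hu'
      by_cases hC : u' ∈ C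
      · exact .inr hC
      · exact .inl ⟨hfamD v hvD hu', hC, fun hd => hex ⟨u', hu', hC, hd⟩⟩

end DSep

/-! ### Recursive systems with independent noise. -/

section Structural

variable {ι Ω : Type*} {mΩ : MeasurableSpace Ω} {μ : Measure Ω} {G : Digraph ι}
  {m n : ι → MeasurableSpace Ω}

/-- The σ-algebra generated by the members of the family `m` with index in `S`. -/
@[reducible] def sigma (m : ι → MeasurableSpace Ω) (S : Set ι) : MeasurableSpace Ω := ⨆ i ∈ S, m i

theorem sigma_mono {S T : Set ι} (h : S ⊆ T) : sigma m S ≤ sigma m T := biSup_mono h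

theorem sigma_union (S T : Set ι) : sigma m (S ∪ T) = sigma m S ⊔ sigma m T := iSup_union

theorem le_sigma {S : Set ι} {i : ι} (hi : i ∈ S) : m i ≤ sigma m S := le_iSup₂_of_le i hi le_rfl

theorem sigma_le {S : Set ι} {m' : MeasurableSpace Ω} (h : ∀ i ∈ S, m i ≤ m') : sigma m S ≤ m' :=
  iSup₂_le h

theorem sigma_diff_singleton_sup {S : Set ι} {i : ι} (hi : i ∈ S) :
    sigma m (S \ {i}) ⊔ m i = sigma m S := by
  conv_rhs => rw [← Set.sdiff_union_of_subset (Set.singleton_subset_iff.2 hi), sigma_union]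
  simp [sigma]

theorem IsAcyclic.wellFounded [Finite ι] (hG : IsAcyclic G) : WellFounded G.Adj := by
  have : Std.Irrefl (Relation.TransGen G.Adj) := ⟨hG⟩
  exact Subrelation.wf (fun h => Relation.TransGen.single h)
    (Finite.wellFounded_of_trans_of_irrefl (Relation.TransGen G.Adj))

theorem IsAcyclic.exists_sink [Finite ι] (hG : IsAcyclic G) {D : Set ι} (hD : D.Nonempty) :
    ∃ v ∈ D, ∀ w ∈ D, ¬ G.Adj v w := by
  have : Std.Irrefl (Relation.TransGen (flip G.Adj)) :=
    ⟨fun v hv => hG v (Relation.transGen_swap.1 hv)⟩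
  obtain ⟨v, hv, h⟩ := (Finite.wellFounded_of_trans_of_irrefl
    (Relation.TransGen (flip G.Adj))).has_min D hD
  exact ⟨v, hv, fun w hw hvw => h w hw (.single hvw)⟩

/-- In a recursive system, each variable is a function of the noise at its ancestors. -/
theorem le_sigma_noise [Finite ι] (hG : IsAcyclic G)
    (hrec : ∀ i, m i ≤ n i ⊔ sigma m {j | G.Adj j i}) {D : Set ι}
    (hD : ∀ i ∈ D, ∀ j, G.Adj j i → j ∈ D) (i : ι) (hi : i ∈ D) : m i ≤ sigma n D := by
  induction i using hG.wellFounded.induction with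
  | _ i ih =>
    exact (hrec i).trans (sup_le (le_sigma hi) (sigma_le fun j hj => ih j hj (hD i hi j hj)))

variable [StandardBorelSpace Ω] [IsFiniteMeasure μ]

theorem condIndep_congr {m' m'' m₁ m₂ : MeasurableSpace Ω} {hm' : m' ≤ mΩ} (e : m' = m'')
    (h : CondIndep m' m₁ m₂ hm' μ) : CondIndep m'' m₁ m₂ (e ▸ hm') μ := by
  subst e; exact h

/-- A variable is independent of the variables in an ancestral set not containing it, given any part
of this set that contains its parents. -/
theorem condIndep_sigma_of_parents_subset [Finite ι] (hG : IsAcyclic G) (hm : ∀ i, m i ≤ mΩ)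
    (hn : ∀ i, n i ≤ mΩ) (hind : ∀ i D, i ∉ D → Indep (n i) (sigma n D) μ)
    (hrec : ∀ i, m i ≤ n i ⊔ sigma m {j | G.Adj j i}) {D S : Set ι}
    (hD : ∀ i ∈ D, ∀ j, G.Adj j i → j ∈ D) {v : ι} (hv : v ∉ D) (hS : S ⊆ D)
    (hpa : ∀ j, G.Adj j v → j ∈ S) :
    CondIndep (sigma m S) (m v) (sigma m D) (sigma_le fun i _ => hm i) μ := by
  have hD' : sigma m D ≤ mΩ := sigma_le fun i _ => hm i
  -- As `D` is ancestral, its variables are functions of the noise in `D`, which excludes `n v`.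
  have hnD : Indep (n v) (sigma m D) μ := indep_of_indep_of_le_right (hind v D hv)
    (sigma_le fun i hi => le_sigma_noise hG hrec hD i hi)
  refine (condIndep_of_condIndep_of_le_right (condIndep_sup_self_right hD' (hn v)
    (condIndep_of_indep_of_le hD' (hn v) hnD (sigma_mono hS))) ?_).symm
  exact (hrec v).trans (sup_le_sup_left (sigma_mono hpa) _)

/-- The Markov property for the partitions of an ancestral set into three parts of which the first
two are not connected by an edge of the moral graph. -/
theorem condIndep_sigma_of_partition [Finite ι] (hG : IsAcyclic G) (hm : ∀ i, m i ≤ mΩ)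
    (hn : ∀ i, n i ≤ mΩ) (hind : ∀ i D, i ∉ D → Indep (n i) (sigma n D) μ)
    (hrec : ∀ i, m i ≤ n i ⊔ sigma m {j | G.Adj j i}) (k : ℕ) {A B C : Set ι}
    (hk : (A ∪ B ∪ C).ncard = k)
    (hAB : Disjoint A B) (hAC : Disjoint A C) (hBC : Disjoint B C)
    (hD : ∀ i ∈ A ∪ B ∪ C, ∀ j, G.Adj j i → j ∈ A ∪ B ∪ C)
    (hfam : ∀ i ∈ A ∪ B ∪ C, family G i ⊆ A ∪ C ∨ family G i ⊆ B ∪ C) :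
    CondIndep (sigma m C) (sigma m A) (sigma m B) (sigma_le fun i _ => hm i) μ := by
  have hσ : ∀ S, sigma m S ≤ mΩ := fun S => sigma_le fun i _ => hm i
  induction k generalizing A B C with
  | zero =>
    have : A = ∅ := by
      have := (Set.ncard_eq_zero (Set.toFinite _)).1 hk
      simp only [Set.union_empty_iff] at this
      exact this.1.1
    subst this
    have : sigma m ∅ = ⊥ := by simp [sigma]
    rw [this]
    exact condIndep_bot_left _
  | succ k ih =>
    obtain ⟨v, hv, hsink⟩ := hG.exists_sink (D := A ∪ B ∪ C)
      ((Set.ncard_pos (Set.toFinite _)).1 (by omega))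
    -- The case where the family of the sink `v` lies in `A ∪ C`; the other case is its mirror
    -- image. Deleting a sink keeps the set ancestral and leaves the other families intact.
    have step : ∀ {A B : Set ι}, (A ∪ B ∪ C).ncard = k + 1 → Disjoint A B → Disjoint A C →
        Disjoint B C → (∀ i ∈ A ∪ B ∪ C, ∀ j, G.Adj j i → j ∈ A ∪ B ∪ C) →
        (∀ i ∈ A ∪ B ∪ C, family G i ⊆ A ∪ C ∨ family G i ⊆ B ∪ C) → v ∈ A ∪ B ∪ C →
        (∀ w ∈ A ∪ B ∪ C, ¬ G.Adj v w) → family G v ⊆ A ∪ C →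
        CondIndep (sigma m C) (sigma m A) (sigma m B) (hσ _) μ := by
      intro A B hk hAB hAC hBC hD hfam hv hsink hvf
      have hvB : v ∉ B := by
        intro hvB
        rcases hvf (Set.mem_insert _ _) with h | h
        exacts [Set.disjoint_left.1 hAB h hvB, Set.disjoint_left.1 hBC hvB h]
      have hcard : ((A ∪ B ∪ C) \ {v}).ncard = k := by
        rw [Set.ncard_sdiff_singleton_of_mem hv]; omega
      have hD' : ∀ i ∈ (A ∪ B ∪ C) \ {v}, ∀ j, G.Adj j i → j ∈ (A ∪ B ∪ C) \ {v} := by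
        rintro i ⟨hi, -⟩ j hj
        exact ⟨hD i hi j hj, fun e => hsink i hi ((Set.mem_singleton_iff.1 e) ▸ hj)⟩
      have hvnf : ∀ i ∈ A ∪ B ∪ C, i ≠ v → v ∉ family G i := by
        rintro i hi hne (h | h)
        exacts [hne h.symm, hsink i hi h]
      have hpa : ∀ j, G.Adj j v → j ∈ A ∪ C ∧ j ≠ v := by
        intro j hj
        exact ⟨hvf (Set.mem_insert_of_mem _ hj), fun e => hsink v hv (e ▸ hj)⟩
      -- If `v ∈ A`, then `v` is independent of `B` given `C` and the rest of `A`, and contraction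
      -- restores it to `A`.
      rcases hvf (Set.mem_insert _ _) with hvA | hvC
      · have hvC : v ∉ C := Set.disjoint_left.1 hAC hvA
        have e : (A \ {v}) ∪ B ∪ C = (A ∪ B ∪ C) \ {v} := by
          ext x; by_cases hx : x = v
          · subst hx; simp [hvB, hvC]
          · simp [hx]
        have h1 : CondIndep (sigma m C) (sigma m (A \ {v})) (sigma m B) (hσ _) μ := by
          refine ih (by rwa [e]) (hAB.mono_left Set.sdiff_subset) (hAC.mono_left Set.sdiff_subset)
            hBC (by rwa [e]) ?_
          rw [e]
          rintro i ⟨hi, hiv⟩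
          refine (hfam i hi).imp_left fun h x hx => (h hx).imp_left fun hxA => ⟨hxA, ?_⟩
          rintro rfl
          exact hvnf i hi hiv hx
        have h2 : CondIndep (sigma m (C ∪ A \ {v})) (m v) (sigma m B) (hσ _) μ := by
          refine condIndep_of_condIndep_of_le_right (condIndep_sigma_of_parents_subset hG hm hn
            hind hrec hD' (v := v) (by simp) ?_ ?_) (sigma_mono ?_)
          · rw [← e]
            exact Set.union_subset Set.subset_union_right
              (Set.subset_union_left.trans Set.subset_union_left)
          · intro j hj
            obtain ⟨h | h, hne⟩ := hpa j hj
            exacts [.inr ⟨h, hne⟩, .inl h]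
          · rw [← e]
            exact Set.subset_union_right.trans Set.subset_union_left
        have h3 := condIndep_sup_left (hσ _) (hσ _) (hm v) h1
          (condIndep_congr (sigma_union _ _) h2)
        rwa [sigma_diff_singleton_sup hvA] at h3
      -- If `v ∈ C`, contraction first adjoins `v` to `A`, and weak union then moves it into the
      -- conditioning.
      · have hvA : v ∉ A := fun h => Set.disjoint_left.1 hAC h hvC
        have e : A ∪ B ∪ (C \ {v}) = (A ∪ B ∪ C) \ {v} := by
          ext x; by_cases hx : x = v
          · subst hx; simp [hvB, hvA]
          · simp [hx]
        have h1 : CondIndep (sigma m (C \ {v})) (sigma m A) (sigma m B) (hσ _) μ := by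
          refine ih (by rwa [e]) hAB (hAC.mono_right Set.sdiff_subset)
            (hBC.mono_right Set.sdiff_subset) (by rwa [e]) ?_
          rw [e]
          rintro i ⟨hi, hiv⟩
          have hne : ∀ x ∈ family G i, x ≠ v := fun x hx hxv => hvnf i hi hiv (hxv ▸ hx)
          exact (hfam i hi).imp (fun h x hx => (h hx).imp_right fun hxC => ⟨hxC, hne x hx⟩)
            (fun h x hx => (h hx).imp_right fun hxC => ⟨hxC, hne x hx⟩)
        have h2 : CondIndep (sigma m (C \ {v} ∪ A)) (m v) (sigma m B) (hσ _) μ := by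
          refine condIndep_of_condIndep_of_le_right (condIndep_sigma_of_parents_subset hG hm hn
            hind hrec hD' (v := v) (by simp) ?_ ?_) (sigma_mono ?_)
          · rw [← e]
            exact Set.union_subset Set.subset_union_right
              (Set.subset_union_left.trans Set.subset_union_left)
          · intro j hj
            obtain ⟨h | h, hne⟩ := hpa j hj
            exacts [.inr h, .inl ⟨h, hne⟩]
          · rw [← e]
            exact Set.subset_union_right.trans Set.subset_union_left
        have h3 := condIndep_sup_left (hσ _) (hσ _) (hm v) h1
          (condIndep_congr (sigma_union _ _) h2)
        exact condIndep_congr (sigma_diff_singleton_sup hvC)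
          (condIndep_sup_of_condIndep_sup_left (hσ _) (hσ _) (hm v) h3)
    rcases hfam v hv with h | h
    · exact step hk hAB hAC hBC hD hfam hv hsink h
    · rw [Set.union_comm A B] at hk hD hfam hv hsink
      exact (step hk hAB.symm hBC hAC hD (fun i hi => (hfam i hi).symm) hv hsink h).symm

/-- The directed global Markov property of a recursive system with independent noise. -/
theorem DSep.condIndep_sigma [Finite ι] (hG : IsAcyclic G) (hm : ∀ i, m i ≤ mΩ)
    (hn : ∀ i, n i ≤ mΩ) (hind : ∀ i D, i ∉ D → Indep (n i) (sigma n D) μ)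
    (hrec : ∀ i, m i ≤ n i ⊔ sigma m {j | G.Adj j i}) {A B C : Set ι}
    (hAC : Disjoint A C) (hBC : Disjoint B C) (h : DSep G A B C) :
    CondIndep (sigma m C) (sigma m A) (sigma m B) (sigma_le fun i _ => hm i) μ := by
  obtain ⟨A', B', hA, hB, hAB', hAC', hBC', hD, hfam⟩ := h.exists_partition hAC hBC
  refine condIndep_of_condIndep_of_le_left (condIndep_of_condIndep_of_le_right
    (condIndep_sigma_of_partition hG hm hn hind hrec _ rfl hAB' hAC' hBC' ?_ hfam)
    (sigma_mono hB)) (sigma_mono hA)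
  rw [hD]
  exact fun i hi j hj => mem_ancestors_of_adj hj hi

end Structural

/-! ### Acyclicity of the condensation. -/

section Condensation

variable {V : Type*} {G : Digraph V}

theorem reaches_of_reaches_condensation {c d : SCC G} (h : Reaches (condensation G) c d)
    {u v : V} (hu : scc G u = c) (hv : scc G v = d) : Reaches G u v := by
  induction h generalizing v with
  | refl => exact (Quotient.exact (hu.trans hv.symm)).1
  | tail _ hbc ih =>
    obtain ⟨x, y, hxy, -, rfl, rfl⟩ := hbc
    exact ((ih rfl).tail hxy).trans (Quotient.exact hv.symm).1

/-- The first edge `u → v` of a cycle leaves its component, but the rest of the cycle lifts to a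
path from `v` back to `u`. -/
theorem isAcyclic_condensation (G : Digraph V) : IsAcyclic (condensation G) := by
  intro c hc
  obtain ⟨d, ⟨u, v, huv, hne, rfl, rfl⟩, hdc⟩ := Relation.TransGen.head'_iff.1 hc
  exact hne (Quotient.sound ⟨.single huv, reaches_of_reaches_condensation hdc rfl rfl⟩)

theorem IsAcyclic.antisymm {c d : V} (hG : IsAcyclic G) (hcd : Reaches G c d)
    (hdc : Reaches G d c) : c = d := by
  rcases Relation.reflTransGen_iff_eq_or_transGen.1 hcd with h | h
  · exact h.symm
  · exact (hG c (h.trans_left hdc)).elim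

end Condensation

/-! ### Diagonal blocks of block triangular matrices. -/

section Matrix

variable {V α R : Type*} [Fintype V] [DecidableEq V] [CommRing R]

theorem det_toSquareBlock_ne_zero [Finite α] [DecidableEq α] [PartialOrder α] {M : Matrix V V R}
    {b : V → α} (hM : ∀ i j, M i j ≠ 0 → b i ≤ b j) (hdet : M.det ≠ 0) (a : α) :
    (M.toSquareBlock b a).det ≠ 0 := by
  -- The block determinant formula needs a linear order on the labels; a linear extension of the
  -- partial order keeps the same blocks.
  have : Fintype (LinearExtension α) := Fintype.ofFinite α
  let _ : DecidableEq (LinearExtension α) := inferInstanceAs (DecidableEq α)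
  have hbt : M.BlockTriangular (fun v => toLinearExtension (b v)) := by
    intro i j hij
    by_contra h
    exact absurd (toLinearExtension.monotone (hM i j h)) (not_le.2 hij)
  rw [hbt.det_fintype] at hdet
  intro h0
  refine hdet (Finset.prod_eq_zero (Finset.mem_univ (toLinearExtension a)) h0)

end Matrix

/-! ### Cluster values and their σ-algebras. -/

section ClusterVariables

variable {V : Type*}

/-- The vertex values that make up a family of cluster values. -/
def coord (G : Digraph V) (x : ∀ c : SCC G, Cluster G c → ℝ) (v : V) : ℝ := x (scc G v) ⟨v, rfl⟩

theorem coord_cluster (G : Digraph V) (x : ∀ c : SCC G, Cluster G c → ℝ) {c : SCC G}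
    (v : Cluster G c) : coord G x v = x c v := by
  obtain ⟨v, rfl⟩ := v
  rfl

theorem measurable_coord (G : Digraph V) (v : V) : Measurable fun x => coord G x v :=
  (measurable_pi_apply _).comp (measurable_pi_apply (scc G v))

/-- The σ-algebra of the cluster variable of a component. -/
@[reducible] def clusterSigma (G : Digraph V) (c : SCC G) :
    MeasurableSpace (∀ c : SCC G, Cluster G c → ℝ) :=
  MeasurableSpace.comap (fun x => x c) inferInstance

theorem clusterSigma_le (G : Digraph V) (c : SCC G) : clusterSigma G c ≤ MeasurableSpace.pi :=
  (measurable_pi_apply c).comap_le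

theorem comap_proj_eq_sigma (G : Digraph V) (A : Set (SCC G)) :
    MeasurableSpace.comap (proj (fun c => Cluster G c → ℝ) A) inferInstance =
      sigma (clusterSigma G) A := by
  change MeasurableSpace.comap _ (⨆ i : A, _) = _
  rw [MeasurableSpace.comap_iSup, sigma, iSup_subtype']
  refine iSup_congr fun i => ?_
  rw [MeasurableSpace.comap_comp]
  rfl

end ClusterVariables

theorem measurable_mulVec_add_sum {E κ κ' : Type*} {_ : MeasurableSpace E} [Fintype κ] [Fintype κ']
    (N : Matrix κ κ ℝ) (b : κ → κ' → ℝ) {f : E → κ → ℝ} {g : E → κ' → ℝ}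
    (hf : ∀ w, Measurable fun x => f x w) (hg : ∀ w u, b w u ≠ 0 → Measurable fun x => g x u) :
    Measurable fun x => N.mulVec fun w => f x w + ∑ u, b w u * g x u := by
  refine measurable_pi_lambda _ fun v => Finset.measurable_fun_sum _ fun w _ =>
    Measurable.const_mul ((hf w).add (Finset.measurable_fun_sum _ fun u _ => ?_)) _
  by_cases hb : b w u = 0
  · simp only [hb, zero_mul]
    exact measurable_const
  · exact (hg w u hb).const_mul _

theorem iIndepFun_map {ι Ω Ω' : Type*} [MeasurableSpace Ω] [MeasurableSpace Ω'] {β : ι → Type*}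
    [∀ i, MeasurableSpace (β i)] {μ : Measure Ω} {Φ : Ω → Ω'} (hΦ : AEMeasurable Φ μ)
    {f : ∀ i, Ω' → β i} (hf : ∀ i, Measurable (f i)) (h : iIndepFun (fun i ω => f i (Φ ω)) μ) :
    iIndepFun f (μ.map Φ) := by
  rw [iIndepFun_iff_measure_inter_preimage_eq_mul] at h ⊢
  intro S s hs
  rw [Measure.map_apply_of_aemeasurable hΦ (S.measurableSet_biInter fun i hi => hf i (hs i hi)),
    Finset.prod_congr rfl fun i hi => Measure.map_apply_of_aemeasurable hΦ (hf i (hs i hi))]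
  simp only [Set.preimage_iInter]
  exact h S hs

/-! ### The linear model as a recursive system of clusters. -/

section Linear

variable {V Ω : Type*} [Fintype V] [DecidableEq V]

/-- Each diagonal block of `1 - B` along the strongly connected components is invertible. -/
theorem det_toSquareBlock_scc_ne_zero {B : Matrix V V ℝ} [DecidableEq (SCC (graph B))]
    (h : (1 - B).det ≠ 0) (c : SCC (graph B)) :
    ((1 - B).toSquareBlock (scc (graph B)) c).det ≠ 0 := by
  -- Reachability is reversed because a nonzero entry `B i j` is an edge `j → i`.
  let _ : PartialOrder (SCC (graph B)) :=
    { le := fun c d => Reaches (condensation (graph B)) d c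
      le_refl := fun _ => .refl
      le_trans := fun _ _ _ h k => k.trans h
      le_antisymm := fun _ _ h k => (isAcyclic_condensation _).antisymm k h }
  refine det_toSquareBlock_ne_zero (fun i j hij => ?_) h c
  by_cases hs : scc (graph B) j = scc (graph B) i
  · exact hs.ge
  · refine Relation.ReflTransGen.single ⟨j, i, ?_, hs, rfl, rfl⟩
    have hne : i ≠ j := fun e => hs (e ▸ rfl)
    simpa [graph, Matrix.one_apply_ne hne] using hij

/-- The noise value at a vertex, as a function of the cluster values. -/
def residual (B : Matrix V V ℝ) (v : V) (x : ∀ c : SCC (graph B), Cluster (graph B) c → ℝ) : ℝ :=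
  ∑ u, (1 - B) v u * coord (graph B) x u

theorem measurable_residual (B : Matrix V V ℝ) (v : V) : Measurable (residual B v) :=
  Finset.measurable_fun_sum _ fun u _ => (measurable_coord _ u).const_mul _

/-- The σ-algebra of the noise variables of a component. -/
@[reducible] def noiseSigma (B : Matrix V V ℝ) (c : SCC (graph B)) :
    MeasurableSpace (∀ c : SCC (graph B), Cluster (graph B) c → ℝ) :=
  sigma (fun v => MeasurableSpace.comap (residual B v) inferInstance) {v | scc (graph B) v = c}

theorem noiseSigma_le (B : Matrix V V ℝ) (c : SCC (graph B)) :
    noiseSigma B c ≤ MeasurableSpace.pi :=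
  sigma_le fun v _ => (measurable_residual B v).comap_le

theorem mulVec_cluster (B : Matrix V V ℝ) [DecidableEq (SCC (graph B))]
    (x : ∀ c : SCC (graph B), Cluster (graph B) c → ℝ) (c : SCC (graph B)) :
    ((1 - B).toSquareBlock (scc (graph B)) c).mulVec (x c) = fun w : Cluster (graph B) c =>
      residual B w x + ∑ u : {u // ¬ scc (graph B) u = c}, B w u * coord (graph B) x u := by
  ext w
  have h := Fintype.sum_subtype_add_sum_subtype (fun u => scc (graph B) u = c)
    (fun u => (1 - B) w.1 u * coord (graph B) x u)
  have h' : ∀ u : {u // ¬ scc (graph B) u = c}, (1 - B) w.1 u.1 = - B w.1 u.1 := by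
    intro u
    have hne : w.1 ≠ u.1 := fun e => u.2 (e ▸ w.2)
    simp [Matrix.one_apply_ne hne]
  rw [residual, ← h]
  simp only [h', neg_mul, Finset.sum_neg_distrib, neg_add_cancel_right]
  refine Finset.sum_congr rfl fun u _ => ?_
  rw [coord_cluster _ _ u]
  rfl

theorem cluster_eq_mulVec {B : Matrix V V ℝ} [DecidableEq (SCC (graph B))] (h : (1 - B).det ≠ 0)
    (x : ∀ c : SCC (graph B), Cluster (graph B) c → ℝ) (c : SCC (graph B)) :
    x c = ((1 - B).toSquareBlock (scc (graph B)) c)⁻¹.mulVec (fun w : Cluster (graph B) c =>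
      residual B w x + ∑ u : {u // ¬ scc (graph B) u = c}, B w u * coord (graph B) x u) := by
  rw [← mulVec_cluster, Matrix.mulVec_mulVec, Matrix.nonsing_inv_mul, Matrix.one_mulVec]
  exact (det_toSquareBlock_scc_ne_zero h c).isUnit

/-- The σ-algebra `m` is left free so that it can be the one generated by the component's noise and
its parent clusters. -/
theorem measurable_cluster {B : Matrix V V ℝ} (h : (1 - B).det ≠ 0) (c : SCC (graph B))
    {m : MeasurableSpace (∀ c : SCC (graph B), Cluster (graph B) c → ℝ)}
    (hres : ∀ w : Cluster (graph B) c, Measurable[m] (residual B w))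
    (hpa : ∀ (w : Cluster (graph B) c) (u : {u // ¬ scc (graph B) u = c}), B w u ≠ 0 →
      Measurable[m] fun x => coord (graph B) x u) :
    Measurable[m] fun x : ∀ c : SCC (graph B), Cluster (graph B) c → ℝ => x c := by
  classical
  rw [funext fun x => cluster_eq_mulVec h x c]
  exact measurable_mulVec_add_sum _ _ hres hpa

/-- The structural equations of the components. -/
theorem clusterSigma_le_sup {B : Matrix V V ℝ} (h : (1 - B).det ≠ 0) (c : SCC (graph B)) :
    clusterSigma (graph B) c ≤ noiseSigma B c ⊔
      sigma (clusterSigma (graph B)) {d | (condensation (graph B)).Adj d c} := by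
  refine (measurable_cluster h c (fun w => ?_) (fun w u hB => ?_)).comap_le
  · exact measurable_iff_comap_le.2 (le_sup_of_le_left
      (le_sigma (m := fun v => MeasurableSpace.comap (residual B v) inferInstance) w.2))
  · exact (measurable_pi_apply _).comp (measurable_iff_comap_le.2 (le_sup_of_le_right
      (le_sigma (m := clusterSigma (graph B)) ⟨u, w, hB, fun e => u.2 (e.trans w.2), rfl, w.2⟩)))

theorem sigma_noiseSigma (B : Matrix V V ℝ) (D : Set (SCC (graph B))) :
    sigma (noiseSigma B) D =
      sigma (fun v => MeasurableSpace.comap (residual B v) inferInstance)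
        {v | scc (graph B) v ∈ D} := by
  apply le_antisymm
  · refine sigma_le fun c hc => sigma_mono ?_
    rintro v rfl
    exact hc
  · refine sigma_le fun v hv => ?_
    exact (le_sigma (m := fun v => MeasurableSpace.comap (residual B v) inferInstance)
      (S := {u | scc (graph B) u = scc (graph B) v}) rfl).trans (le_sigma (m := noiseSigma B) hv)

variable [MeasurableSpace Ω] {μ : Measure Ω} {B : Matrix V V ℝ} {ε X : V → Ω → ℝ}

theorem IsLinearSCM.ae_mulVec_eq (hX : IsLinearSCM μ B ε X) :
    ∀ᵐ ω ∂μ, (1 - B).mulVec (fun v => X v ω) = fun v => ε v ω := by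
  filter_upwards [hX.structural_eq] with ω h
  ext v
  rw [Matrix.sub_mulVec, Matrix.one_mulVec, Pi.sub_apply, h v]
  simp [Matrix.mulVec, dotProduct]

/-- `X` is not assumed measurable, but it agrees almost surely with `(1 - B)⁻¹ ε`. -/
theorem IsLinearSCM.aemeasurable (hX : IsLinearSCM μ B ε X) (v : V) : AEMeasurable (X v) μ := by
  refine ⟨fun ω => (1 - B)⁻¹.mulVec (fun v => ε v ω) v, ?_, ?_⟩
  · exact Finset.measurable_fun_sum _ fun u _ => (hX.measurable_noise u).const_mul _
  · filter_upwards [hX.ae_mulVec_eq] with ω h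
    rw [← h, Matrix.mulVec_mulVec, Matrix.nonsing_inv_mul _ hX.det_ne_zero.isUnit,
      Matrix.one_mulVec]

/-- Composed with the cluster variables, the residuals are almost surely the noise. Working with the
law on the space of cluster values, which is standard Borel, avoids any regularity assumption on
`Ω`. -/
theorem IsLinearSCM.iIndepFun_residual (hX : IsLinearSCM μ B ε X) :
    iIndepFun (residual B) (clusterLaw μ (graph B) X) := by
  have hΦ : AEMeasurable (fun ω (c : SCC (graph B)) (v : Cluster (graph B) c) => X v ω) μ :=
    aemeasurable_pi_lambda _ fun c => aemeasurable_pi_lambda _ fun v => hX.aemeasurable v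
  refine iIndepFun_map hΦ (measurable_residual B) ((iIndepFun_congr fun v => ?_).1 hX.indep_noise)
  filter_upwards [hX.ae_mulVec_eq] with ω h
  exact (congrFun h v).symm

theorem IsLinearSCM.indep_noiseSigma (hX : IsLinearSCM μ B ε X) (c : SCC (graph B))
    (D : Set (SCC (graph B))) (hc : c ∉ D) :
    Indep (noiseSigma B c) (sigma (noiseSigma B) D) (clusterLaw μ (graph B) X) := by
  rw [sigma_noiseSigma]
  refine indep_iSup_of_disjoint (fun v => (measurable_residual B v).comap_le)
    hX.iIndepFun_residual.iIndep (Set.disjoint_left.2 ?_)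
  rintro v rfl hv
  exact hc hv

theorem IsLinearSCM.isMarkov [IsFiniteMeasure μ] (hX : IsLinearSCM μ B ε X) :
    IsMarkov (condensation (graph B)) (clusterLaw μ (graph B) X) := by
  intro S T Z _ hSZ hTZ hsep
  rw [condIndepFun_iff_condIndep, comap_proj_eq_sigma _ S, comap_proj_eq_sigma _ T]
  exact condIndep_congr (comap_proj_eq_sigma _ Z).symm
    (hsep.condIndep_sigma (isAcyclic_condensation _) (clusterSigma_le _) (noiseSigma_le B)
      hX.indep_noiseSigma (clusterSigma_le_sup hX.det_ne_zero) hSZ hTZ)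

end Linear

end CyclicSCM

theorem lemma1 {V Ω : Type*} [Fintype V] [DecidableEq V] [MeasurableSpace Ω]
    (μ : MeasureTheory.Measure Ω) [MeasureTheory.IsProbabilityMeasure μ]
    (B : Matrix V V ℝ) (ε X : V → Ω → ℝ) (hX : CyclicSCM.IsLinearSCM μ B ε X) :
    CyclicSCM.IsAcyclic (CyclicSCM.condensation (CyclicSCM.graph B)) ∧
      CyclicSCM.IsMarkov (CyclicSCM.condensation (CyclicSCM.graph B))
        (CyclicSCM.clusterLaw μ (CyclicSCM.graph B) X) :=
  ⟨CyclicSCM.isAcyclic_condensation _, hX.isMarkov⟩
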